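/- Let $n\ge 0$ and $\lambda=(\lambda_1,\dots,\lambda_n)\in[0,1]^n$. A $\lambda$-contaminated dataset from a distribution $P$ on $\mathbb R$ is $Z=(Z_1,\dots,Z_n)$ with $Z_i=(1-B_i)X_i+B_i\tilde X_i$, where $X_1,\dots,X_n$ are i.i.d. from $P$, $B_i\sim\mathrm{Bern}(\lambda_i)$ are independent of each other and of the $X_i$, and the outliers $(\tilde X_1,\dots,\tilde X_n)$ are drawn by an adversary from an arbitrary joint distribution conditional on all $X_i$ and all $B_i$. Let $\mathcal D$ be the set of all distributions $\mathcal N(\mu,1)$, $\mu\in\mathbb R$, write $\mu_P$ for the mean of $P$, and define the minimax PAC rate $$L_{\mathsf{PAC}}(\lambda)=\inf\Big\{r\ge 0:\ \inf_M\ \sup_{P\in\mathcal D,\ \text{adversary}}\Pr\big[(M(Z)-\mu_P)^2\ge r\big]\le \tfrac15\Big\},$$ where $M$ ranges over all (measurable) estimators $M:\mathbb R^n\to\mathbb R$. For $t\in[0,1]$ let $N(t)=|\{i:\lambda_i\le t\}|$ (with $1/0=\infty$) and let $w(t)_i=\mathbf 1\{\lambda_i\le t\}/N(t)$. For weights $w$,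 a weighted Tukey median of $z\in\mathbb R^n$ is a maximizer over $\eta\in\mathbb R$ of the depth $\min_{v\in\{-1,1\}}\sum_i w_i\mathbf 1\{v(z_i-\eta)\ge 0\}$; for $w=w(t)$ with $N(t)>0$ this is a median of the samples with $\lambda_i\le t$. There are universal constants $c,a,A>0$ such that, for all $n$ and $\lambda\in[0,1]^n$ for which $$f(\lambda)=\min_{t\in[0,1]}\Big(t^2+\frac1{N(t)}\Big)$$ satisfies $f(\lambda)\le c$, one has $$a\,f(\lambda)\ \le\ L_{\mathsf{PAC}}(\lambda)\ \le\ A\,f(\lambda).$$ Moreover the minimum is attained, and for every minimizer $t^*\in[0,1]$ the Tukey median with weights $w(t^*)$ (that is, the median of the samples with $\lambda_i\le t^*$) achieves this rate: a measurable choice $M(z)$ of such a median for every $z$ exists, and every choice $M$ satisfies $\Pr[(M(Z)-\mu_P)^2\ge A\,f(\lambda)]\le \tfrac15$ for every $P\in\mathcal D$ and every adversary. -/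

import Mathlib

open MeasureTheory ProbabilityTheory
open scoped ENNReal

noncomputable section

namespace HeteroRobust

/-- An adversary: a conditional law of the outliers `(X̃₁, …, X̃ₙ)` given all clean samples
`(X₁, …, Xₙ)` and all corruption indicators `(B₁, …, Bₙ)` (`true` means corrupted). -/
abbrev Adversary (n : ℕ) (E : Type*) [MeasurableSpace E] :=
  {κ : Kernel ((Fin n → E) × (Fin n → Bool)) (Fin n → E) // IsMarkovKernel κ}

/-- The dataset `Zᵢ = (1 - Bᵢ) Xᵢ + Bᵢ X̃ᵢ`. -/
def mix {n : ℕ} {E : Type*} (s : ((Fin n → E) × (Fin n → Bool)) × (Fin n → E)) : Fin n → E :=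
  fun i => if s.1.2 i then s.2 i else s.1.1 i

/-- The law of a `lam`-contaminated dataset from `P` against the adversary `κ`: the `Xᵢ` are
i.i.d. from `P`, the `Bᵢ` are independent Bernoulli of parameter `lam i`, independent of the `Xᵢ`,
and the outliers are drawn from `κ` given these. -/
def contaminatedLaw {n : ℕ} {E : Type*} [MeasurableSpace E] (lam : Fin n → unitInterval)
    (P : ProbabilityMeasure E) (κ : Adversary n E) : Measure (Fin n → E) :=
  ((((Measure.pi fun _ : Fin n => (P : Measure E)).prod
    (Measure.pi fun i : Fin n => bernoulliMeasure true false (lam i))) ⊗ₘ κ.1).map mix)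

/-- The mean `μ_P` of a distribution. -/
def mean {E : Type*} [NormedAddCommGroup E] [NormedSpace ℝ E] [MeasurableSpace E]
    (P : ProbabilityMeasure E) : E :=
  ∫ x, x ∂(P : Measure E)

/-- The probability, under contaminated data, that the squared error of `M` is at least `r`. -/
def errorProb {n : ℕ} {E : Type*} [NormedAddCommGroup E] [NormedSpace ℝ E] [MeasurableSpace E]
    (lam : Fin n → unitInterval) (P : ProbabilityMeasure E) (κ : Adversary n E)
    (M : (Fin n → E) → E) (r : ℝ≥0∞) : ℝ≥0∞ :=
  contaminatedLaw lam P κ {z | r ≤ ENNReal.ofReal (‖M z - mean P‖ ^ 2)}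

/-- The minimax PAC rate at confidence level `δ`. The infimum runs over all (measurable)
estimators, the supremum over all distributions of the class and all adversaries. -/
def pacRate {n : ℕ} {E : Type*} [NormedAddCommGroup E] [NormedSpace ℝ E] [MeasurableSpace E]
    (lam : Fin n → unitInterval) (D : Set (ProbabilityMeasure E)) (δ : ℝ≥0∞) : ℝ≥0∞ :=
  sInf {r : ℝ≥0∞ | (⨅ M : {M : (Fin n → E) → E // Measurable M},
    ⨆ P ∈ D, ⨆ κ : Adversary n E, errorProb lam P κ M.1 r) ≤ δ}

/-- The univariate Gaussian distributions of unit variance. -/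
def unitGaussians : Set (ProbabilityMeasure ℝ) :=
  {P | ∃ m : ℝ, (P : Measure ℝ) = gaussianReal m 1}

/-- `N(t)`, the number of samples of corruption rate at most `t`. -/
def numBelow {n : ℕ} (lam : Fin n → unitInterval) (t : ℝ) : ℕ :=
  (Finset.univ.filter fun i => (lam i : ℝ) ≤ t).card

/-- `t² + 1 / N(t)`, which is `∞` when `N(t) = 0`. -/
def thresholdRate {n : ℕ} (lam : Fin n → unitInterval) (t : ℝ) : ℝ≥0∞ :=
  ENNReal.ofReal (t ^ 2) + 1 / (numBelow lam t : ℝ≥0∞)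

/-- The value `min_{t ∈ [0, 1]} (t² + 1 / N(t))`. -/
def minRate {n : ℕ} (lam : Fin n → unitInterval) : ℝ≥0∞ :=
  ⨅ t ∈ Set.Icc (0 : ℝ) 1, thresholdRate lam t

/-- The weights `w(t)ᵢ = 1{lam i ≤ t} / N(t)`. -/
def thresholdWeight {n : ℕ} (lam : Fin n → unitInterval) (t : ℝ) (i : Fin n) : ℝ :=
  (if (lam i : ℝ) ≤ t then 1 else 0) / (numBelow lam t : ℝ)

open Classical in
/-- The weighted Tukey depth
`D_w(η, z) = min over unit vectors v of ∑ᵢ wᵢ 1{⟨v, zᵢ - η⟩ ≥ 0}`. -/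
def tukeyDepth {n : ℕ} {E : Type*} [NormedAddCommGroup E] [InnerProductSpace ℝ E]
    (w : Fin n → ℝ) (z : Fin n → E) (η : E) : ℝ :=
  ⨅ v : Metric.sphere (0 : E) 1, ∑ i, w i * (if 0 ≤ inner ℝ (v : E) (z i - η) then 1 else 0)

/-- `η` is a weighted Tukey median of `z`: a point of maximal weighted depth. -/
def IsTukeyMedian {n : ℕ} {E : Type*} [NormedAddCommGroup E] [InnerProductSpace ℝ E]
    (w : Fin n → ℝ) (z : Fin n → E) (η : E) : Prop :=
  ∀ η' : E, tukeyDepth w z η' ≤ tukeyDepth w z η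

end HeteroRobust

end

open MeasureTheory ProbabilityTheory
open scoped ENNReal

namespace HeteroRobust

/-! Write `F` for the minimum of `t² + 1/N(t)`.

Upper bound: a median can lie beyond `m + s` only if at least half of the selected samples do.
Whatever the adversary does, such a sample is corrupted or has its clean value beyond `m + s`. These
events are independent across samples, of probability at most `t + 1/2 - s/5` each. With `s = 15√F`
this is at most `1/2 - 2√F`, and Chebyshev's inequality bounds the chance of a majority by `1/(16 N
F) ≤ 1/16`; the other tail is symmetric. This is `contaminatedLaw_card_le_two_mul_card_filter_le`
and `errorProb_le_of_isTukeyMedian`.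

Lower bound: compare `N(0,1)` and `N(Δ,1)` with `Δ = √F/4`. Their total variation distance is at
most `2Δ`, so samples of rate above `2Δ` can be made identically distributed under both
(`exists_contaminate_eq`). The remaining `N(2Δ)` samples are left effectively clean and have
likelihood ratio of second moment `exp(N(2Δ) Δ²)`. Minimality of `F` at the threshold `2Δ` keeps
this below `5/4`, so some mean is missed by `Δ/2` with probability at least `1/4 > 1/5`
(`exists_quarter_le_errorProb`). -/

/-! ### Weighted Tukey depth on the line as a count -/

lemma tukeyDepth_real {n : ℕ} (w z : Fin n → ℝ) (η : ℝ) :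
    tukeyDepth w z η = min (∑ i, w i * (if η ≤ z i then 1 else 0))
      (∑ i, w i * (if z i ≤ η then 1 else 0)) := by
  classical
  unfold tukeyDepth
  have key : ∀ v : Metric.sphere (0 : ℝ) 1, (v : ℝ) = 1 ∨ (v : ℝ) = -1 := by
    rintro ⟨v, hv⟩
    have : |v| = 1 := by simpa using hv
    exact (abs_eq zero_le_one).1 this
  have h1 : (1 : ℝ) ∈ Metric.sphere (0 : ℝ) 1 := by simp
  have h2 : (-1 : ℝ) ∈ Metric.sphere (0 : ℝ) 1 := by simp
  have : Nonempty (Metric.sphere (0 : ℝ) 1) := ⟨⟨1, h1⟩⟩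
  have e1 : ∀ i, (0 ≤ inner ℝ (1 : ℝ) (z i - η)) ↔ η ≤ z i := fun i => by simp
  have e2 : ∀ i, (0 ≤ inner ℝ (-1 : ℝ) (z i - η)) ↔ z i ≤ η := fun i => by simp
  have lb : ∀ v : Metric.sphere (0 : ℝ) 1,
      min (∑ i, w i * (if η ≤ z i then 1 else 0)) (∑ i, w i * (if z i ≤ η then 1 else 0)) ≤
        ∑ i, w i * (if 0 ≤ inner ℝ (v : ℝ) (z i - η) then 1 else 0) := by
    intro v
    rcases key v with h | h <;> rw [h]
    · simp only [e1]; exact min_le_left _ _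
    · simp only [e2]; exact min_le_right _ _
  have bdd : BddBelow (Set.range fun v : Metric.sphere (0 : ℝ) 1 =>
      ∑ i, w i * (if 0 ≤ inner ℝ (v : ℝ) (z i - η) then 1 else 0)) :=
    ⟨_, by rintro _ ⟨v, rfl⟩; exact lb v⟩
  refine le_antisymm (le_min ?_ ?_) (le_ciInf lb)
  · refine (ciInf_le bdd ⟨1, h1⟩).trans (le_of_eq ?_)
    simp only [e1]
  · refine (ciInf_le bdd ⟨-1, h2⟩).trans (le_of_eq ?_)
    simp only [e2]

/-- The samples of corruption rate at most `t`. -/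
noncomputable def samplesBelow {n : ℕ} (lam : Fin n → unitInterval) (t : ℝ) : Finset (Fin n) :=
  Finset.univ.filter fun i => (lam i : ℝ) ≤ t

lemma card_samplesBelow {n : ℕ} (lam : Fin n → unitInterval) (t : ℝ) :
    (samplesBelow lam t).card = numBelow lam t := rfl

lemma sum_thresholdWeight_mul {n : ℕ} (lam : Fin n → unitInterval) (t : ℝ) (p : Fin n → Prop)
    [DecidablePred p] :
    ∑ i, thresholdWeight lam t i * (if p i then 1 else 0) =
      (((samplesBelow lam t).filter p).card : ℝ) / numBelow lam t := by
  rw [samplesBelow, Finset.filter_filter, Finset.card_filter, Nat.cast_sum, Finset.sum_div]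
  refine Finset.sum_congr rfl fun i _ => ?_
  unfold thresholdWeight
  by_cases h : (lam i : ℝ) ≤ t <;> by_cases h' : p i <;> simp [h, h']

/-- The number of samples of `S` on the scarcer side of `η`, `η` included. -/
noncomputable def sideCount {n : ℕ} (S : Finset (Fin n)) (z : Fin n → ℝ) (η : ℝ) : ℕ :=
  min (S.filter fun i => η ≤ z i).card (S.filter fun i => z i ≤ η).card

lemma tukeyDepth_thresholdWeight {n : ℕ} (lam : Fin n → unitInterval) (t : ℝ) (z : Fin n → ℝ)
    (η : ℝ) : tukeyDepth (thresholdWeight lam t) z η =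
      (sideCount (samplesBelow lam t) z η : ℝ) / numBelow lam t := by
  rw [tukeyDepth_real, sum_thresholdWeight_mul, sum_thresholdWeight_mul, sideCount, Nat.cast_min,
    min_div_div_right (Nat.cast_nonneg _)]

lemma isTukeyMedian_thresholdWeight_iff {n : ℕ} (lam : Fin n → unitInterval) (t : ℝ)
    (hN : 0 < numBelow lam t) (z : Fin n → ℝ) (η : ℝ) :
    IsTukeyMedian (thresholdWeight lam t) z η ↔
      ∀ η', sideCount (samplesBelow lam t) z η' ≤ sideCount (samplesBelow lam t) z η := by
  have : (0 : ℝ) < numBelow lam t := by exact_mod_cast hN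
  simp only [IsTukeyMedian, tukeyDepth_thresholdWeight, div_le_div_iff_of_pos_right this,
    Nat.cast_le]

/-! ### The lower median: a measurable deepest point -/

/-- The lower median of the samples of `S`. -/
noncomputable def lowerMedian {n : ℕ} (S : Finset (Fin n)) (z : Fin n → ℝ) : ℝ :=
  sInf {x | S.card ≤ 2 * (S.filter fun i => z i ≤ x).card}

section

variable {n : ℕ} {S : Finset (Fin n)}

/-- The count of samples below `x` is unchanged when `x` drops to the largest sample below it, so
the infimum runs over finitely many sample values. -/
lemma isLeast_lowerMedian (hS : S.Nonempty) (z : Fin n → ℝ) :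
    IsLeast {x | S.card ≤ 2 * (S.filter fun i => z i ≤ x).card} (lowerMedian S z) := by
  have hpos : 0 < S.card := hS.card_pos
  let C := S.filter fun j => S.card ≤ 2 * (S.filter fun i => z i ≤ z j).card
  have attained : ∀ x, S.card ≤ 2 * (S.filter fun i => z i ≤ x).card → ∃ j ∈ C, z j ≤ x := by
    intro x hx
    have hne : (S.filter fun i => z i ≤ x).Nonempty := by
      rw [← Finset.card_pos]; omega
    obtain ⟨j, hj, hmax⟩ := Finset.exists_max_image _ z hne
    rw [Finset.mem_filter] at hj
    refine ⟨j, Finset.mem_filter.2 ⟨hj.1, hx.trans ?_⟩, hj.2⟩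
    gcongr 2 * ?_
    exact Finset.card_le_card fun i hi =>
      Finset.mem_filter.2 ⟨(Finset.mem_filter.1 hi).1, hmax i hi⟩
  obtain ⟨j₀, -, hj₀⟩ := Finset.exists_max_image S z hS
  have hC : C.Nonempty := by
    obtain ⟨j, hj, -⟩ := attained (z j₀) (by rw [Finset.filter_true_of_mem hj₀]; omega)
    exact ⟨j, hj⟩
  obtain ⟨m, hm, hmin⟩ := Finset.exists_min_image C z hC
  have hL : IsLeast {x | S.card ≤ 2 * (S.filter fun i => z i ≤ x).card} (z m) := by
    refine ⟨(Finset.mem_filter.1 hm).2, fun x hx => ?_⟩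
    obtain ⟨j, hj, hjx⟩ := attained x hx
    exact (hmin j hj).trans hjx
  rw [lowerMedian, hL.csInf_eq]
  exact hL

/-- Turns sublevel sets into counting events, which yields both the measurability and the depth of
the lower median. -/
lemma lowerMedian_le_iff (hS : S.Nonempty) (z : Fin n → ℝ) (x : ℝ) :
    lowerMedian S z ≤ x ↔ S.card ≤ 2 * (S.filter fun i => z i ≤ x).card := by
  obtain ⟨h1, h2⟩ := isLeast_lowerMedian hS z
  refine ⟨fun h => le_trans h1 ?_, fun h => h2 h⟩
  gcongr

lemma card_le_two_mul_card_lowerMedian_le (hS : S.Nonempty) (z : Fin n → ℝ) :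
    S.card ≤ 2 * (S.filter fun i => lowerMedian S z ≤ z i).card := by
  have hsplit := Finset.card_filter_add_card_filter_not (s := S) (fun i => lowerMedian S z ≤ z i)
  suffices 2 * (S.filter fun i => ¬ lowerMedian S z ≤ z i).card ≤ S.card by omega
  rcases (S.filter fun i => ¬ lowerMedian S z ≤ z i).eq_empty_or_nonempty with h | h
  · rw [h]; simp
  obtain ⟨j, hj, hmax⟩ := Finset.exists_max_image _ z h
  have hlt := (Finset.mem_filter.1 hj).2
  rw [lowerMedian_le_iff hS] at hlt
  have : (S.filter fun i => ¬ lowerMedian S z ≤ z i).card ≤ (S.filter fun i => z i ≤ z j).card :=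
    Finset.card_le_card fun i hi => Finset.mem_filter.2 ⟨(Finset.mem_filter.1 hi).1, hmax i hi⟩
  omega

lemma card_le_two_mul_sideCount_lowerMedian (hS : S.Nonempty) (z : Fin n → ℝ) :
    S.card ≤ 2 * sideCount S z (lowerMedian S z) := by
  have h1 := (lowerMedian_le_iff hS z _).1 le_rfl
  have h2 := card_le_two_mul_card_lowerMedian_le hS z
  rw [sideCount]
  omega

/-- To the left of the lower median fewer than half of the samples lie below `η`, by leastness. To
the right, the samples above `η` are among those strictly above the median, which are at most as
many as those on either closed side of it. -/
lemma sideCount_le_sideCount_lowerMedian (hS : S.Nonempty) (z : Fin n → ℝ) (η : ℝ) :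
    sideCount S z η ≤ sideCount S z (lowerMedian S z) := by
  have h1 := (lowerMedian_le_iff hS z _).1 le_rfl
  have h2 := card_le_two_mul_card_lowerMedian_le hS z
  rcases lt_trichotomy η (lowerMedian S z) with h | h | h
  · have h3 := mt (lowerMedian_le_iff hS z η).2 h.not_ge
    simp only [sideCount]
    omega
  · rw [h]
  · have hsplit := Finset.card_filter_add_card_filter_not (s := S)
      (fun i => z i ≤ lowerMedian S z)
    have h3 : (S.filter fun i => η ≤ z i).card ≤
        (S.filter fun i => ¬ z i ≤ lowerMedian S z).card :=
      Finset.card_le_card fun i hi => Finset.mem_filter.2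
        ⟨(Finset.mem_filter.1 hi).1, not_le.2 (h.trans_le (Finset.mem_filter.1 hi).2)⟩
    have h4 : (S.filter fun i => ¬ z i ≤ lowerMedian S z).card ≤
        (S.filter fun i => lowerMedian S z ≤ z i).card :=
      Finset.card_le_card fun i hi => Finset.mem_filter.2
        ⟨(Finset.mem_filter.1 hi).1, (not_le.1 (Finset.mem_filter.1 hi).2).le⟩
    simp only [sideCount]
    omega

lemma measurableSet_card_le_two_mul_card_filter {Ω : Type*} [MeasurableSpace Ω] (N : ℕ)
    (p : Fin n → Ω → Prop) [∀ i ω, Decidable (p i ω)] (hp : ∀ i, MeasurableSet {ω | p i ω}) :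
    MeasurableSet {ω | N ≤ 2 * (S.filter fun i => p i ω).card} := by
  simp only [Finset.card_filter]
  refine measurableSet_le measurable_const (Measurable.const_mul ?_ _)
  exact Finset.measurable_sum _ fun i _ =>
    Measurable.ite (hp i) measurable_const measurable_const

lemma measurable_lowerMedian (hS : S.Nonempty) :
    Measurable (lowerMedian S : (Fin n → ℝ) → ℝ) := by
  refine measurable_of_Iic fun x => ?_
  have : lowerMedian S ⁻¹' Set.Iic x =
      {z | S.card ≤ 2 * (S.filter fun i => z i ≤ x).card} := by
    ext z
    exact lowerMedian_le_iff hS z x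
  rw [this]
  exact measurableSet_card_le_two_mul_card_filter _ _ fun i =>
    measurableSet_le (measurable_pi_apply i) measurable_const

end

lemma samplesBelow_nonempty {n : ℕ} {lam : Fin n → unitInterval} {t : ℝ}
    (hN : 0 < numBelow lam t) : (samplesBelow lam t).Nonempty :=
  Finset.card_pos.1 hN

lemma isTukeyMedian_lowerMedian {n : ℕ} {lam : Fin n → unitInterval} {t : ℝ}
    (hN : 0 < numBelow lam t) (z : Fin n → ℝ) :
    IsTukeyMedian (thresholdWeight lam t) z (lowerMedian (samplesBelow lam t) z) :=
  (isTukeyMedian_thresholdWeight_iff lam t hN z _).2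
    (sideCount_le_sideCount_lowerMedian (samplesBelow_nonempty hN) z)

/-- The only property of a median that the error bound uses; it holds because the lower median
already has half of the samples on each closed side. -/
lemma IsTukeyMedian.numBelow_le_two_mul_sideCount {n : ℕ} {lam : Fin n → unitInterval} {t : ℝ}
    (hN : 0 < numBelow lam t) {z : Fin n → ℝ} {η : ℝ}
    (h : IsTukeyMedian (thresholdWeight lam t) z η) :
    numBelow lam t ≤ 2 * sideCount (samplesBelow lam t) z η := by
  have h1 := (isTukeyMedian_thresholdWeight_iff lam t hN z _).1 h
    (lowerMedian (samplesBelow lam t) z)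
  have h2 := card_le_two_mul_sideCount_lowerMedian (samplesBelow_nonempty hN) z
  rw [card_samplesBelow] at h2
  omega

/-! ### Existence of an optimal threshold -/

/-- Some threshold in `[0, 1]` minimizes `t² + 1 / N(t)`. -/
lemma exists_isMinOn_thresholdRate {n : ℕ} (lam : Fin n → unitInterval) :
    ∃ t ∈ Set.Icc (0 : ℝ) 1, IsMinOn (thresholdRate lam) (Set.Icc 0 1) t := by
  rcases isEmpty_or_nonempty (Fin n) with hn | hn
  · refine ⟨0, by simp, fun t _ => ?_⟩
    have : numBelow lam t = 0 := by simp [numBelow, Finset.univ_eq_empty]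
    simp [thresholdRate, this]
  obtain ⟨i, -, hi⟩ := Finset.exists_min_image Finset.univ
    (fun i => thresholdRate lam (lam i)) Finset.univ_nonempty
  refine ⟨lam i, (lam i).2, fun t ht => ?_⟩
  rcases (samplesBelow lam t).eq_empty_or_nonempty with h | h
  · have : numBelow lam t = 0 := by rw [← card_samplesBelow, h, Finset.card_empty]
    simp [thresholdRate, this]
  -- Lowering `t` to the largest rate below it loses no sample and does not increase `t²`, so only
  -- the finitely many rates compete.
  · obtain ⟨j, hj, hmax⟩ := Finset.exists_max_image _ (fun i => (lam i : ℝ)) h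
    refine (hi j (Finset.mem_univ _)).trans ?_
    have hjt : (lam j : ℝ) ≤ t := (Finset.mem_filter.1 hj).2
    have hN : numBelow lam t ≤ numBelow lam (lam j) :=
      Finset.card_le_card fun k hk =>
        Finset.mem_filter.2 ⟨Finset.mem_univ _, hmax k hk⟩
    unfold thresholdRate
    gcongr
    exact (lam j).2.1

lemma minRate_eq_of_isMinOn {n : ℕ} {lam : Fin n → unitInterval} {t : ℝ}
    (ht : t ∈ Set.Icc (0 : ℝ) 1) (h : IsMinOn (thresholdRate lam) (Set.Icc 0 1) t) :
    minRate lam = thresholdRate lam t :=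
  le_antisymm (iInf₂_le t ht) (le_iInf₂ fun _ hs => h hs)

/-! ### Concentration against an arbitrary adversary -/

/-- Chebyshev's inequality for the number of successes among independent trials, each of
probability at most `1/2 - d`. -/
lemma pi_card_le_two_mul_card_filter_le {n : ℕ} {Ω : Fin n → Type*}
    [∀ i, MeasurableSpace (Ω i)] (μ : ∀ i, Measure (Ω i)) [∀ i, IsProbabilityMeasure (μ i)]
    (S : Finset (Fin n)) (hS : S.Nonempty) (V : ∀ i, Set (Ω i)) (hV : ∀ i, MeasurableSet (V i))
    [∀ i x, Decidable (x ∈ V i)] (d : ℝ) (hd : 0 < d)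
    (hp : ∀ i ∈ S, (μ i).real (V i) ≤ 1 / 2 - d) :
    Measure.pi μ {y | S.card ≤ 2 * (S.filter fun i => y i ∈ V i).card} ≤
      ENNReal.ofReal (1 / (4 * S.card * d ^ 2)) := by
  have hcard : (0 : ℝ) < S.card := by exact_mod_cast hS.card_pos
  let Y : ∀ i, Ω i → ℝ := fun i => (V i).indicator 1
  have hYm : ∀ i, Measurable (Y i) := fun i => measurable_one.indicator (hV i)
  have hYb : ∀ i x, Y i x ∈ Set.Icc (0 : ℝ) 1 := fun i x => by
    by_cases h : x ∈ V i <;> simp [Y, h]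
  let X : Fin n → (∀ i, Ω i) → ℝ := fun i y => Y i (y i)
  have hXm : ∀ i, Measurable (X i) := fun i => (hYm i).comp (measurable_pi_apply i)
  have hXL : ∀ i, MemLp (X i) 2 (Measure.pi μ) := fun i =>
    MemLp.of_bound (hXm i).aestronglyMeasurable 1 (.of_forall fun y => by
      rw [Real.norm_eq_abs, abs_le]
      have := hYb i (y i)
      exact ⟨by linarith [this.1], this.2⟩)
  have hind : iIndepFun X (Measure.pi μ) := iIndepFun_pi fun i => (hYm i).aemeasurable
  have hvar : Var[∑ i ∈ S, X i; Measure.pi μ] ≤ S.card / 4 := by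
    rw [IndepFun.variance_sum (fun i _ => hXL i)
      (fun i _ j _ hij => hind.indepFun hij)]
    calc ∑ i ∈ S, Var[X i; Measure.pi μ] ≤ ∑ i ∈ S, ((1 - 0) / 2 : ℝ) ^ 2 :=
          Finset.sum_le_sum fun i _ => variance_le_sq_of_bounded
            (.of_forall fun y => hYb i (y i)) (hXm i).aemeasurable
      _ = S.card / 4 := by rw [Finset.sum_const, nsmul_eq_mul]; ring
  have hmean : ∀ i, ∫ y, X i y ∂Measure.pi μ = (μ i).real (V i) := fun i => by
    rw [← integral_indicator_one (hV i)]
    have hmap := (measurePreserving_eval μ i).map_eq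
    conv_rhs => rw [← hmap]
    exact (integral_map_of_stronglyMeasurable (measurable_pi_apply i)
      (hYm i).stronglyMeasurable).symm
  have hE : ∫ y, (∑ i ∈ S, X i) y ∂Measure.pi μ ≤ S.card * (1 / 2 - d) := by
    simp only [Finset.sum_apply]
    rw [integral_finsetSum _ fun i _ => (hXL i).integrable (by norm_num)]
    calc ∑ i ∈ S, ∫ y, X i y ∂Measure.pi μ ≤ ∑ i ∈ S, (1 / 2 - d) :=
          Finset.sum_le_sum fun i hi => by rw [hmean]; exact hp i hi
      _ = _ := by rw [Finset.sum_const, nsmul_eq_mul]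
  -- A count of at least `card / 2` exceeds its mean, at most `card * (1/2 - d)`, by at least `card
  -- * d`.
  have hc : 0 < S.card * d := by positivity
  refine (measure_mono fun y hy => ?_).trans ((meas_ge_le_variance_div_sq
    (memLp_finsetSum' S fun i _ => hXL i) hc).trans (ENNReal.ofReal_le_ofReal ?_))
  · have hsum : (∑ i ∈ S, X i) y = ((S.filter fun i => y i ∈ V i).card : ℝ) := by
      rw [Finset.sum_apply, Finset.card_filter, Nat.cast_sum]
      refine Finset.sum_congr rfl fun i _ => ?_
      by_cases h : y i ∈ V i <;> simp [X, Y, h]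
    have hy' : (S.card : ℝ) ≤ 2 * ((S.filter fun i => y i ∈ V i).card : ℝ) := by exact_mod_cast hy
    rw [Set.mem_ofPred_eq, hsum]
    refine le_trans ?_ (le_abs_self _)
    linarith
  · calc Var[∑ i ∈ S, X i; Measure.pi μ] / (S.card * d) ^ 2
        ≤ (S.card / 4) / (S.card * d) ^ 2 := by gcongr
      _ = 1 / (4 * S.card * d ^ 2) := by field_simp

lemma measurable_mix {n : ℕ} {E : Type*} [MeasurableSpace E] :
    Measurable (mix : ((Fin n → E) × (Fin n → Bool)) × (Fin n → E) → Fin n → E) := by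
  refine measurable_pi_lambda _ fun i => ?_
  refine Measurable.ite ?_ (by fun_prop) (by fun_prop)
  exact (by fun_prop : Measurable fun s : ((Fin n → E) × (Fin n → Bool)) × (Fin n → E) => s.1.2 i)
    (measurableSet_singleton true)

/-- Whatever the adversary does, at most half of the samples of low corruption rate land in a set
of mass well below `1/2`, with high probability. -/
lemma contaminatedLaw_card_le_two_mul_card_filter_le {n : ℕ} {E : Type*} [MeasurableSpace E]
    (lam : Fin n → unitInterval) (P : ProbabilityMeasure E) (κ : Adversary n E)
    (S : Finset (Fin n)) (hS : S.Nonempty) (T : Set E) (hT : MeasurableSet T)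
    [DecidablePred (· ∈ T)] (t d : ℝ) (hd : 0 < d) (hlam : ∀ i ∈ S, (lam i : ℝ) ≤ t)
    (hp : (P : Measure E).real T + t ≤ 1 / 2 - d) :
    contaminatedLaw lam P κ {z | S.card ≤ 2 * (S.filter fun i => z i ∈ T).card} ≤
      ENNReal.ofReal (1 / (4 * S.card * d ^ 2)) := by
  have hκ := κ.2
  have hmeas : MeasurableSet {z : Fin n → E | S.card ≤ 2 * (S.filter fun i => z i ∈ T).card} :=
    measurableSet_card_le_two_mul_card_filter _ _ fun i => measurable_pi_apply i hT
  -- Every corrupted sample is conceded to the adversary. The resulting event ignores the outliers,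
  -- so the kernel integrates out and independence across samples is recovered.
  let V : Set (E × Bool) := {y | y.1 ∈ T ∨ y.2 = true}
  have hV : MeasurableSet V :=
    (measurable_fst hT).union (measurable_snd (measurableSet_singleton true))
  classical
  let W : Set ((Fin n → E) × (Fin n → Bool)) :=
    {s | S.card ≤ 2 * (S.filter fun i => (s.1 i, s.2 i) ∈ V).card}
  have hW : MeasurableSet W := measurableSet_card_le_two_mul_card_filter _ _ fun i =>
    (by fun_prop : Measurable fun s : (Fin n → E) × (Fin n → Bool) => (s.1 i, s.2 i)) hV
  rw [contaminatedLaw, Measure.map_apply measurable_mix hmeas]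
  calc _ ≤ _ := measure_mono (t := Prod.fst ⁻¹' W) fun s hs => ?_
    _ = ((Measure.pi fun _ : Fin n => (P : Measure E)).prod
        (Measure.pi fun i : Fin n => bernoulliMeasure true false (lam i))) W := by
      rw [← Measure.fst_apply hW, Measure.fst_compProd]
    _ = (Measure.pi fun i => (P : Measure E).prod (bernoulliMeasure true false (lam i)))
        {y | S.card ≤ 2 * (S.filter fun i => y i ∈ V).card} := by
      rw [← (measurePreserving_arrowProdEquivProdArrow E Bool (Fin n) (fun _ => (P : Measure E))
        (fun i => bernoulliMeasure true false (lam i))).measure_preimage hW.nullMeasurableSet]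
      rfl
    _ ≤ _ := by
      refine pi_card_le_two_mul_card_filter_le _ S hS (fun _ => V) (fun _ => hV) d hd
        fun i hi => ?_
      have hVeq : V = (T ×ˢ Set.univ) ∪ (Set.univ ×ˢ {true}) := by
        ext ⟨x, b⟩; simp [V]
      rw [hVeq]
      refine (measureReal_union_le _ _).trans ?_
      rw [measureReal_prod_prod, measureReal_prod_prod]
      have := hlam i hi
      simp only [probReal_univ, one_mul, mul_one]
      rw [bernoulliMeasure_real_apply_of_mem_of_notMem _ (measurableSet_singleton _)
        (by simp) (by simp)]
      linarith
  · refine le_trans (b := 2 * (S.filter fun i => mix s i ∈ T).card) hs ?_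
    change _ ≤ 2 * (S.filter fun i => (s.1.1 i, s.1.2 i) ∈ V).card
    gcongr 2 * ?_
    refine Finset.card_le_card fun i hi => ?_
    rw [Finset.mem_filter] at hi ⊢
    refine ⟨hi.1, ?_⟩
    by_cases hb : s.1.2 i = true
    · exact Or.inr hb
    · left
      simpa [mix, hb] using hi.2

/-! ### Gaussian tails near the mean -/

lemma one_fifth_le_gaussianPDFReal {x : ℝ} (hx : |x| ≤ 1) : 1 / 5 ≤ gaussianPDFReal 0 1 x := by
  rw [gaussianPDFReal]
  have hx2 : x ^ 2 ≤ 1 := by rw [← sq_abs]; nlinarith [abs_nonneg x]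
  have h1 : (3 / 5 : ℝ) ≤ Real.exp (-(1 / 2)) := by
    have h2 : Real.exp (-(1 / 2) : ℝ) ^ 2 = Real.exp (-1) := by
      rw [← Real.exp_nat_mul]; norm_num
    have h3 := Real.exp_neg_one_gt_d9
    nlinarith [Real.exp_pos (-(1 / 2) : ℝ)]
  have h4 : Real.exp (-(1 / 2)) ≤ Real.exp (-(x - 0) ^ 2 / (2 * ((1 : NNReal) : ℝ))) := by
    apply Real.exp_le_exp.2
    push_cast
    nlinarith
  have h5 : √(2 * Real.pi * ((1 : NNReal) : ℝ)) ≤ 3 := by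
    rw [Real.sqrt_le_left (by norm_num)]
    push_cast
    nlinarith [Real.pi_lt_d2]
  have h6 : (1 / 3 : ℝ) ≤ (√(2 * Real.pi * ((1 : NNReal) : ℝ)))⁻¹ := by
    rw [one_div]
    exact inv_anti₀ (Real.sqrt_pos.2 (by push_cast; positivity)) h5
  calc (1 / 5 : ℝ) = 1 / 3 * (3 / 5) := by norm_num
    _ ≤ _ := by
      apply mul_le_mul h6 (h1.trans h4) (by norm_num) (by positivity)

lemma gaussianReal_real_Iic_neg (s : ℝ) :
    (gaussianReal 0 1).real (Set.Iic (-s)) = (gaussianReal 0 1).real (Set.Ici s) := by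
  have h : (gaussianReal 0 1).map (fun x => -x) = gaussianReal 0 1 := by
    rw [gaussianReal_map_neg, neg_zero]
  conv_lhs => rw [← h]
  rw [map_measureReal_apply measurable_neg measurableSet_Iic]
  congr 1
  ext x
  simp

/-- The density is at least `1/5` on `[-1, 1]`, so `(-s, s)` has mass at least `2s/5`, and the two
tails share the rest equally. -/
lemma gaussianReal_real_Ici_le {s : ℝ} (h0 : 0 < s) (h1 : s ≤ 1) :
    (gaussianReal 0 1).real (Set.Ici s) ≤ 1 / 2 - s / 5 := by
  have hlow : 2 * s / 5 ≤ (gaussianReal 0 1).real (Set.Ioo (-s) s) := by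
    rw [measureReal_def, gaussianReal_apply_eq_integral _ one_ne_zero, ENNReal.toReal_ofReal
      (setIntegral_nonneg measurableSet_Ioo fun x _ => gaussianPDFReal_nonneg _ _ _)]
    calc 2 * s / 5 = ∫ _ in Set.Ioo (-s) s, (1 / 5 : ℝ) := by
          simp [measureReal_def, Real.volume_Ioo]
          rw [ENNReal.toReal_ofReal (by linarith)]; ring
      _ ≤ _ := setIntegral_mono_on (by simp) (integrable_gaussianPDFReal 0 1).integrableOn
        measurableSet_Ioo fun x hx => one_fifth_le_gaussianPDFReal
          (abs_le.2 ⟨by linarith [hx.1], by linarith [hx.2]⟩)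
  have hU : (gaussianReal 0 1).real (Set.Iic (-s) ∪ Set.Ioo (-s) s) =
      1 - (gaussianReal 0 1).real (Set.Ici s) := by
    rw [← probReal_compl_eq_one_sub measurableSet_Ici, Set.compl_Ici,
      Set.Iic_union_Ioo_eq_Iio (by linarith)]
  rw [measureReal_union (by
    rw [Set.disjoint_left]; intro x hx hx'; exact absurd hx'.1 (not_lt.2 hx)) measurableSet_Ioo,
    gaussianReal_real_Iic_neg] at hU
  linarith

lemma gaussianReal_real_Ici_add_le (m : ℝ) {s : ℝ} (h0 : 0 < s) (h1 : s ≤ 1) :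
    (gaussianReal m 1).real (Set.Ici (m + s)) ≤ 1 / 2 - s / 5 := by
  refine le_trans (le_of_eq ?_) (gaussianReal_real_Ici_le h0 h1)
  have h : (gaussianReal 0 1).map (fun x => m + x) = gaussianReal m 1 := by
    rw [gaussianReal_map_const_add, zero_add]
  rw [← h, map_measureReal_apply (by fun_prop) measurableSet_Ici]
  congr 1
  ext x
  simp

lemma gaussianReal_real_Iic_sub_le (m : ℝ) {s : ℝ} (h0 : 0 < s) (h1 : s ≤ 1) :
    (gaussianReal m 1).real (Set.Iic (m - s)) ≤ 1 / 2 - s / 5 := by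
  refine le_trans (le_of_eq ?_) ((gaussianReal_real_Iic_neg s).trans_le
    (gaussianReal_real_Ici_le h0 h1))
  have h : (gaussianReal 0 1).map (fun x => m + x) = gaussianReal m 1 := by
    rw [gaussianReal_map_const_add, zero_add]
  rw [← h, map_measureReal_apply (by fun_prop) measurableSet_Iic]
  congr 1
  ext x
  simp [sub_eq_add_neg]

/-! ### Error of the thresholded median -/

lemma numBelow_pos_of_thresholdRate_ne_top {n : ℕ} {lam : Fin n → unitInterval} {t : ℝ}
    (h : thresholdRate lam t ≠ ⊤) : 0 < numBelow lam t := by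
  rw [Nat.pos_iff_ne_zero]
  intro h0
  exact h (by simp [thresholdRate, h0])

lemma thresholdRate_eq_ofReal {n : ℕ} {lam : Fin n → unitInterval} {t : ℝ}
    (h : 0 < numBelow lam t) :
    thresholdRate lam t = ENNReal.ofReal (t ^ 2 + 1 / numBelow lam t) := by
  have h' : (0 : ℝ) < numBelow lam t := by exact_mod_cast h
  rw [thresholdRate, ENNReal.ofReal_add (by positivity) (by positivity),
    ENNReal.ofReal_div_of_pos h', ENNReal.ofReal_one, ENNReal.ofReal_natCast]

lemma mean_eq_of_eq_gaussianReal {P : ProbabilityMeasure ℝ} {m : ℝ}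
    (h : (P : Measure ℝ) = gaussianReal m 1) : mean P = m := by
  rw [mean, h, integral_id_gaussianReal]

/-- Every median of the samples below a threshold with `t² + 1 / N(t)` small has squared error of
order `t² + 1 / N(t)` with probability at least `4/5`. -/
lemma errorProb_le_of_isTukeyMedian {n : ℕ} {lam : Fin n → unitInterval} {t : ℝ}
    (hf : thresholdRate lam t ≤ ENNReal.ofReal (1 / 225))
    {M : (Fin n → ℝ) → ℝ} (hM : ∀ z, IsTukeyMedian (thresholdWeight lam t) z (M z))
    {P : ProbabilityMeasure ℝ} (hP : P ∈ unitGaussians) (κ : Adversary n ℝ) :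
    errorProb lam P κ M (ENNReal.ofReal 225 * thresholdRate lam t) ≤ 1 / 5 := by
  classical
  obtain ⟨m, hm⟩ := hP
  have hN := numBelow_pos_of_thresholdRate_ne_top (ne_top_of_le_ne_top ENNReal.ofReal_ne_top hf)
  have hN' : (0 : ℝ) < numBelow lam t := by exact_mod_cast hN
  rw [thresholdRate_eq_ofReal hN] at hf ⊢
  set F : ℝ := t ^ 2 + 1 / numBelow lam t with hF
  have hFpos : 0 < F := by positivity
  have hF1 : F ≤ 1 / 225 := (ENNReal.ofReal_le_ofReal_iff (by norm_num)).1 hf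
  have hsq : √F ^ 2 = F := Real.sq_sqrt hFpos.le
  have hsqrt : 0 < √F := Real.sqrt_pos.2 hFpos
  -- The threshold `1/225 = 1/15²` keeps the deviation `15√F` in the range of the tail bound. The
  -- tail gains `3√F`, of which contamination costs `t ≤ √F`, leaving the margin `2√F`.
  have hs1 : 15 * √F ≤ 1 := by nlinarith
  have htF : t ≤ √F := Real.le_sqrt_of_sq_le (by rw [hF]; linarith [one_div_pos.2 hN'])
  have hNF : 1 ≤ numBelow lam t * F := by
    rw [hF, mul_add, mul_one_div_cancel hN'.ne']
    nlinarith [mul_nonneg hN'.le (sq_nonneg t)]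
  have hbound : ENNReal.ofReal (1 / (4 * ((samplesBelow lam t).card : ℝ) * (2 * √F) ^ 2)) ≤
      1 / 10 := by
    have h10 : (1 / 10 : ℝ≥0∞) = ENNReal.ofReal (1 / 10) := by
      rw [ENNReal.ofReal_div_of_pos (by norm_num)]; norm_num
    rw [h10, card_samplesBelow]
    refine ENNReal.ofReal_le_ofReal (one_div_le_one_div_of_le (by norm_num) ?_)
    rw [mul_pow, hsq]
    linarith
  have hlam : ∀ i ∈ samplesBelow lam t, (lam i : ℝ) ≤ t := fun i hi => (Finset.mem_filter.1 hi).2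
  have hup := contaminatedLaw_card_le_two_mul_card_filter_le lam P κ (samplesBelow lam t)
    (samplesBelow_nonempty hN) (Set.Ici (m + 15 * √F)) measurableSet_Ici t (2 * √F)
    (by positivity) hlam (by
      have := gaussianReal_real_Ici_add_le m (by positivity) hs1
      rw [hm]; linarith)
  have hdown := contaminatedLaw_card_le_two_mul_card_filter_le lam P κ (samplesBelow lam t)
    (samplesBelow_nonempty hN) (Set.Iic (m - 15 * √F)) measurableSet_Iic t (2 * √F)
    (by positivity) hlam (by
      have := gaussianReal_real_Iic_sub_le m (by positivity) hs1
      rw [hm]; linarith)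
  rw [errorProb, mean_eq_of_eq_gaussianReal hm]
  refine (measure_mono fun z hz => ?_).trans ((measure_union_le _ _).trans
    ((add_le_add (hup.trans hbound) (hdown.trans hbound)).trans ?_))
  · have hz' : 225 * F ≤ ‖M z - m‖ ^ 2 := by
      rw [Set.mem_ofPred_eq, ← ENNReal.ofReal_mul (by norm_num)] at hz
      exact (ENNReal.ofReal_le_ofReal_iff (by positivity)).1 hz
    have habs : 15 * √F ≤ |M z - m| := by
      rw [Real.norm_eq_abs] at hz'
      refine le_of_sq_le_sq ?_ (abs_nonneg _)
      nlinarith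
    have hside := (hM z).numBelow_le_two_mul_sideCount hN
    rw [sideCount] at hside
    rcases le_abs.1 habs with h | h
    · left
      have hmono : ((samplesBelow lam t).filter fun i => M z ≤ z i).card ≤
          ((samplesBelow lam t).filter fun i => z i ∈ Set.Ici (m + 15 * √F)).card :=
        Finset.card_le_card (Finset.monotone_filter_right _ fun i _ hi => by
          simp only [Set.mem_Ici]; linarith)
      rw [Set.mem_ofPred_eq, card_samplesBelow]
      omega
    · right
      have hmono : ((samplesBelow lam t).filter fun i => z i ≤ M z).card ≤
          ((samplesBelow lam t).filter fun i => z i ∈ Set.Iic (m - 15 * √F)).card :=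
        Finset.card_le_card (Finset.monotone_filter_right _ fun i _ hi => by
          simp only [Set.mem_Iic]; linarith)
      rw [Set.mem_ofPred_eq, card_samplesBelow]
      omega
  · rw [← two_mul]
    refine le_of_eq ?_
    rw [show (10 : ℝ≥0∞) = 2 * 5 by norm_num, one_div, one_div,
      ENNReal.mul_inv (by norm_num) (by norm_num), ← mul_assoc,
      ENNReal.mul_inv_cancel (by norm_num) (by norm_num), one_mul]

/-! ### Oblivious adversaries and indistinguishable contaminations -/

/-- The adversary that draws the outliers independently of each other, of the clean samples and of
the corruption indicators, the `i`-th one from `R i`. -/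
noncomputable def obliviousAdversary {n : ℕ} {E : Type*} [MeasurableSpace E] (R : Fin n → Measure E)
    [∀ i, IsProbabilityMeasure (R i)] : Adversary n E :=
  ⟨Kernel.const _ (Measure.pi R), inferInstance⟩

/-- The `lam`-contamination of `P` by `R`. -/
noncomputable def contaminate {E : Type*} [MeasurableSpace E] (lam : unitInterval)
    (P R : Measure E) : Measure E :=
  (unitInterval.toNNReal (unitInterval.symm lam) : ℝ≥0∞) • P +
    (unitInterval.toNNReal lam : ℝ≥0∞) • R

lemma toNNReal_symm_add_toNNReal (lam : unitInterval) :
    (unitInterval.toNNReal (unitInterval.symm lam) : ℝ≥0∞) + unitInterval.toNNReal lam = 1 := by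
  rw [← ENNReal.coe_add, ENNReal.coe_eq_one]
  ext
  simp

instance {E : Type*} [MeasurableSpace E] (lam : unitInterval) (P R : Measure E)
    [IsProbabilityMeasure P] [IsProbabilityMeasure R] :
    IsProbabilityMeasure (contaminate lam P R) :=
  ⟨by simp [contaminate, toNNReal_symm_add_toNNReal]⟩

lemma map_prod_bernoulliMeasure_prod {E : Type*} [MeasurableSpace E] (lam : unitInterval)
    (P R : Measure E) [IsProbabilityMeasure P] [IsProbabilityMeasure R] :
    ((P.prod (bernoulliMeasure true false lam)).prod R).map
      (fun s => if s.1.2 then s.2 else s.1.1) = contaminate lam P R := by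
  have hm : Measurable (fun s : (E × Bool) × E => if s.1.2 then s.2 else s.1.1) :=
    Measurable.ite ((by fun_prop : Measurable fun s : (E × Bool) × E => s.1.2)
      (measurableSet_singleton true)) (by fun_prop) (by fun_prop)
  ext s hs
  rw [Measure.map_apply hm hs]
  have hpre : (fun s : (E × Bool) × E => if s.1.2 then s.2 else s.1.1) ⁻¹' s =
      ((s ×ˢ {false}) ×ˢ Set.univ) ∪ ((Set.univ ×ˢ {true}) ×ˢ s) := by
    ext ⟨⟨x, b⟩, y⟩
    cases b <;> simp
  rw [hpre, measure_union _ ((MeasurableSet.univ.prod (measurableSet_singleton _)).prod hs)]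
  · simp only [Measure.prod_prod, measure_univ, one_mul, mul_one, contaminate,
      Measure.add_apply, Measure.smul_apply, smul_eq_mul]
    rw [bernoulliMeasure_apply_of_mem_of_notMem (s := {true}) _ (measurableSet_singleton _)
        (by simp) (by simp),
      bernoulliMeasure_apply_of_notMem_of_mem (s := {false}) _ (measurableSet_singleton _)
        (by simp) (by simp), mul_comm]
  · rw [Set.disjoint_left]
    rintro ⟨⟨x, b⟩, y⟩ h h'
    simp_all

/-- Against such an adversary the triples of clean value, indicator and outlier are independent
across samples, so regrouping coordinates gives a product law. -/
lemma contaminatedLaw_obliviousAdversary {n : ℕ} {E : Type*} [MeasurableSpace E]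
    (lam : Fin n → unitInterval) (P : ProbabilityMeasure E) (R : Fin n → Measure E)
    [∀ i, IsProbabilityMeasure (R i)] :
    contaminatedLaw lam P (obliviousAdversary R) =
      Measure.pi fun i => contaminate (lam i) (P : Measure E) (R i) := by
  have h1 := measurePreserving_arrowProdEquivProdArrow E Bool (Fin n)
    (fun _ => (P : Measure E)) (fun i => bernoulliMeasure true false (lam i))
  have h2 := measurePreserving_arrowProdEquivProdArrow (E × Bool) E (Fin n)
    (fun i => (P : Measure E).prod (bernoulliMeasure true false (lam i))) R
  have h3 := (h1.prod (MeasurePreserving.id (Measure.pi R))).comp h2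
  have hm : Measurable (fun s : (E × Bool) × E => if s.1.2 then s.2 else s.1.1) :=
    Measurable.ite ((by fun_prop : Measurable fun s : (E × Bool) × E => s.1.2)
      (measurableSet_singleton true)) (by fun_prop) (by fun_prop)
  have hp : ∀ i, IsProbabilityMeasure
      ((((P : Measure E).prod (bernoulliMeasure true false (lam i))).prod (R i)).map
        (fun s => if s.1.2 then s.2 else s.1.1)) := fun i =>
    Measure.isProbabilityMeasure_map hm.aemeasurable
  simp_rw [← map_prod_bernoulliMeasure_prod]
  rw [← Measure.pi_map_pi (fun i => hm.aemeasurable)]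
  change ((_ ⊗ₘ Kernel.const _ (Measure.pi R)).map mix) = _
  rw [Measure.compProd_const, ← h3.map_eq, Measure.map_map measurable_mix h3.measurable]
  rfl

/-- A distribution and one with a density against it, at total variation distance at most `lam`,
become indistinguishable under `lam`-contamination. -/
lemma exists_contaminate_eq {E : Type*} [MeasurableSpace E] (P : Measure E)
    [IsProbabilityMeasure P] (L : E → ℝ≥0∞) (hL : Measurable L) (hL1 : ∫⁻ x, L x ∂P = 1)
    (lam : unitInterval) (h0 : lam ≠ 0)
    (hTV : ∫⁻ x, (L x - 1) ∂P ≤ (unitInterval.toNNReal lam : ℝ≥0∞)) :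
    ∃ R₀ R₁ : Measure E, IsProbabilityMeasure R₀ ∧ IsProbabilityMeasure R₁ ∧
      contaminate lam P R₀ = contaminate lam (P.withDensity L) R₁ := by
  set l : ℝ≥0∞ := (unitInterval.toNNReal lam : ℝ≥0∞) with hl
  set k : ℝ≥0∞ := (unitInterval.toNNReal (unitInterval.symm lam) : ℝ≥0∞) with hk
  have hkl : k + l = 1 := toNNReal_symm_add_toNNReal lam
  have hl0 : l ≠ 0 := by
    rw [hl, ENNReal.coe_ne_zero]
    intro h
    exact h0 (Subtype.ext (by simpa using congrArg NNReal.toReal h))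
  have hlt : l ≠ ⊤ := ENNReal.coe_ne_top
  set D : ℝ≥0∞ := ∫⁻ x, (L x - 1) ∂P with hD
  -- The positive and negative parts of `L - 1` have equal mass, as `L` integrates to `1`.
  have hD' : ∫⁻ x, (1 - L x) ∂P = D := by
    have h1 : ∫⁻ x, (1 + (L x - 1)) ∂P = ∫⁻ x, (L x + (1 - L x)) ∂P := by
      simp_rw [add_tsub_eq_max, max_comm]
    rw [lintegral_add_left measurable_const, lintegral_add_left hL, hL1, lintegral_one,
      measure_univ] at h1
    exact ((ENNReal.add_right_inj ENNReal.one_ne_top).1 h1).symm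
  have hkD : k * D ≤ l := (mul_le_of_le_one_left zero_le (hkl ▸ le_self_add)).trans hTV
  have hprob : ∀ g : E → ℝ≥0∞, ∫⁻ x, g x ∂P = D →
      IsProbabilityMeasure (l⁻¹ • (k • P.withDensity g + (l - k * D) • P)) := fun g hg =>
    ⟨by
      simp only [Measure.smul_apply, Measure.add_apply, smul_eq_mul, measure_univ, mul_one,
        withDensity_apply _ MeasurableSet.univ, setLIntegral_univ, hg]
      rw [add_tsub_cancel_of_le hkD, ENNReal.inv_mul_cancel hl0 hlt]⟩
  have hsmul : ∀ m : Measure E, l • l⁻¹ • m = m := fun m => by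
    rw [smul_smul, ENNReal.mul_inv_cancel hl0 hlt, one_smul]
  -- The outliers lift both clean parts to the common measure `k • max(1, L) P`, at cost `k * D`
  -- each; the unused mass `l - k * D` is spent on `P` in both cases.
  refine ⟨l⁻¹ • (k • P.withDensity (fun x => L x - 1) + (l - k * D) • P),
    l⁻¹ • (k • P.withDensity (fun x => 1 - L x) + (l - k * D) • P),
    hprob _ rfl, hprob _ hD', ?_⟩
  have hmax : P + P.withDensity (fun x => L x - 1) =
      P.withDensity L + P.withDensity (fun x => 1 - L x) := by
    rw [← withDensity_add_left hL]
    nth_rewrite 1 [← withDensity_one (μ := P)]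
    rw [← withDensity_add_left measurable_one]
    congr 1
    ext x
    simp [add_tsub_eq_max, max_comm]
  rw [contaminate, contaminate, ← hl, ← hk, hsmul, hsmul, ← add_assoc, ← add_assoc, ← smul_add,
    ← smul_add, hmax]

/-! ### The Gaussian likelihood ratio -/

/-- The likelihood ratio of `N(Δ, 1)` with respect to `N(0, 1)`. -/
noncomputable def gaussianRatio (Δ x : ℝ) : ℝ≥0∞ := ENNReal.ofReal (Real.exp (Δ * x - Δ ^ 2 / 2))

lemma measurable_gaussianRatio (Δ : ℝ) : Measurable (gaussianRatio Δ) := by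
  unfold gaussianRatio
  fun_prop

lemma withDensity_gaussianRatio (Δ : ℝ) :
    (gaussianReal 0 1).withDensity (gaussianRatio Δ) = gaussianReal Δ 1 := by
  rw [gaussianReal_of_var_ne_zero _ one_ne_zero, gaussianReal_of_var_ne_zero _ one_ne_zero,
    ← withDensity_mul _ (measurable_gaussianPDF 0 1) (measurable_gaussianRatio Δ)]
  congr 1
  ext x
  rw [Pi.mul_apply, gaussianPDF, gaussianPDF, gaussianRatio,
    ← ENNReal.ofReal_mul (gaussianPDFReal_nonneg _ _ _), gaussianPDFReal, gaussianPDFReal,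
    mul_assoc, ← Real.exp_add]
  congr 3
  push_cast
  ring

lemma lintegral_gaussianRatio (Δ : ℝ) : ∫⁻ x, gaussianRatio Δ x ∂gaussianReal 0 1 = 1 := by
  rw [← setLIntegral_univ, ← withDensity_apply _ MeasurableSet.univ, withDensity_gaussianRatio,
    measure_univ]

/-- Squaring the ratio for `Δ` gives `exp(Δ²)` times the ratio for `2Δ`, which integrates to `1`. -/
lemma lintegral_gaussianRatio_sq (Δ : ℝ) :
    ∫⁻ x, gaussianRatio Δ x ^ 2 ∂gaussianReal 0 1 = ENNReal.ofReal (Real.exp (Δ ^ 2)) := by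
  have h : ∀ x, gaussianRatio Δ x ^ 2 =
      ENNReal.ofReal (Real.exp (Δ ^ 2)) * gaussianRatio (2 * Δ) x := fun x => by
    rw [gaussianRatio, gaussianRatio, ← ENNReal.ofReal_pow (Real.exp_pos _).le,
      ← ENNReal.ofReal_mul (Real.exp_pos _).le, ← Real.exp_nat_mul, ← Real.exp_add]
    congr 2
    push_cast
    ring
  simp_rw [h]
  rw [lintegral_const_mul _ (measurable_gaussianRatio _), lintegral_gaussianRatio, mul_one]

/-- The total variation distance between `N(0, 1)` and `N(Δ, 1)` is at most `2 Δ`. -/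
lemma lintegral_gaussianRatio_sub_one_le {Δ : ℝ} (h0 : 0 < Δ) (h1 : Δ ≤ 1) :
    ∫⁻ x, (gaussianRatio Δ x - 1) ∂gaussianReal 0 1 ≤ ENNReal.ofReal (2 * Δ) := by
  -- This is `2Δ(y - 1)⁺ ≤ (y - 1)² + Δ²`, with `2y` moved to the left to avoid a truncated
  -- subtraction. Integrating and using `exp(Δ²) ≤ 1 + 2Δ²` gives `2ΔD ≤ 3Δ²`.
  have hpt : ∀ x, ENNReal.ofReal (2 * Δ) * (gaussianRatio Δ x - 1) + 2 * gaussianRatio Δ x ≤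
      gaussianRatio Δ x ^ 2 + ENNReal.ofReal (1 + Δ ^ 2) := fun x => by
    unfold gaussianRatio
    set y := Real.exp (Δ * x - Δ ^ 2 / 2)
    have hy : 0 < y := Real.exp_pos _
    rw [← ENNReal.ofReal_one, ← ENNReal.ofReal_sub _ zero_le_one,
      ← ENNReal.ofReal_mul (by positivity), ← ENNReal.ofReal_pow hy.le,
      ← ENNReal.ofReal_add (by positivity) (by positivity),
      show (2 : ℝ≥0∞) = ENNReal.ofReal 2 by norm_num, ← ENNReal.ofReal_mul (by norm_num)]
    rcases le_total 1 y with h | h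
    · rw [← ENNReal.ofReal_add (mul_nonneg (by positivity) (by linarith)) (by positivity)]
      exact ENNReal.ofReal_le_ofReal (by nlinarith [sq_nonneg (y - 1 - Δ)])
    · rw [ENNReal.ofReal_of_nonpos (p := 2 * Δ * (y - 1))
        (mul_nonpos_of_nonneg_of_nonpos (by positivity) (by linarith)), zero_add]
      exact ENNReal.ofReal_le_ofReal (by nlinarith [sq_nonneg (y - 1), sq_nonneg Δ])
  have hint := lintegral_mono (μ := gaussianReal 0 1) hpt
  rw [lintegral_add_right _ ((measurable_gaussianRatio Δ).const_mul _),
    lintegral_const_mul _ (by have := measurable_gaussianRatio Δ; fun_prop),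
    lintegral_const_mul _ (measurable_gaussianRatio Δ), lintegral_gaussianRatio,
    lintegral_add_right _ measurable_const, lintegral_gaussianRatio_sq, lintegral_const,
    measure_univ, mul_one, mul_one, ← ENNReal.ofReal_add (by positivity) (by positivity)] at hint
  set D := ∫⁻ x, (gaussianRatio Δ x - 1) ∂gaussianReal 0 1
  have hexp := Real.abs_exp_sub_one_le (x := Δ ^ 2) (by rw [abs_of_nonneg (sq_nonneg _)]; nlinarith)
  rw [abs_of_nonneg (sq_nonneg Δ)] at hexp
  have hexp' := (abs_le.1 hexp).2
  have hle : ENNReal.ofReal (2 * Δ) * D + 2 ≤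
      ENNReal.ofReal (2 * Δ) * ENNReal.ofReal (2 * Δ) + 2 := by
    refine hint.trans ?_
    rw [← ENNReal.ofReal_mul (by positivity), show (2 : ℝ≥0∞) = ENNReal.ofReal 2 by norm_num,
      ← ENNReal.ofReal_add (by positivity) (by positivity)]
    exact ENNReal.ofReal_le_ofReal (by nlinarith [sq_nonneg Δ])
  have hle' := (ENNReal.add_le_add_iff_right (by norm_num)).1 hle
  exact (ENNReal.mul_le_mul_iff_right (by simpa using h0) ENNReal.ofReal_ne_top).1 hle'

/-! ### Product densities and second moments -/

lemma lintegral_pi_prod {n : ℕ} {Ω : Fin n → Type*} [∀ i, MeasurableSpace (Ω i)]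
    (μ : ∀ i, Measure (Ω i)) [∀ i, IsProbabilityMeasure (μ i)] (g : ∀ i, Ω i → ℝ≥0∞)
    (hg : ∀ i, Measurable (g i)) :
    ∫⁻ y, ∏ i, g i (y i) ∂Measure.pi μ = ∏ i, ∫⁻ x, g i x ∂μ i := by
  refine (lintegral_prod_eq_prod_lintegral_of_indepFun Finset.univ
    (fun i (y : ∀ i, Ω i) => g i (y i)) (iIndepFun_pi fun i => (hg i).aemeasurable)
    (fun i => (hg i).comp (measurable_pi_apply i))).trans ?_
  exact Finset.prod_congr rfl fun i _ => (measurePreserving_eval μ i).lintegral_comp (hg i)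

/-- It suffices to compare on boxes, where the indicator times the product density factors over
coordinates. -/
lemma pi_withDensity {n : ℕ} {Ω : Fin n → Type*} [∀ i, MeasurableSpace (Ω i)]
    (μ : ∀ i, Measure (Ω i)) [∀ i, IsProbabilityMeasure (μ i)] (g : ∀ i, Ω i → ℝ≥0∞)
    (hg : ∀ i, Measurable (g i)) [∀ i, IsProbabilityMeasure ((μ i).withDensity (g i))] :
    Measure.pi (fun i => (μ i).withDensity (g i)) =
      (Measure.pi μ).withDensity fun y => ∏ i, g i (y i) := by
  refine Measure.pi_eq fun s hs => ?_
  rw [withDensity_apply _ (MeasurableSet.univ_pi hs),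
    ← lintegral_indicator (MeasurableSet.univ_pi hs)]
  have h : ∀ y, (Set.univ.pi s).indicator (fun y => ∏ i, g i (y i)) y =
      ∏ i, (s i).indicator (g i) (y i) := fun y => by
    by_cases hy : y ∈ Set.univ.pi s
    · rw [Set.indicator_of_mem hy]
      exact Finset.prod_congr rfl fun i _ => (Set.indicator_of_mem (hy i trivial) _).symm
    · rw [Set.indicator_of_notMem hy]
      simp only [Set.mem_pi, Set.mem_univ, true_implies, not_forall] at hy
      obtain ⟨i, hi⟩ := hy
      exact (Finset.prod_eq_zero (Finset.mem_univ i) (Set.indicator_of_notMem hi _)).symm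
  simp_rw [h]
  rw [lintegral_pi_prod μ _ fun i => (hg i).indicator (hs i)]
  refine Finset.prod_congr rfl fun i _ => ?_
  rw [lintegral_indicator (hs i), withDensity_apply _ (hs i)]

/-- If the likelihood ratio of two distributions has second moment at most `5/4`, then they differ
by at most `1/2` on each event. -/
lemma withDensity_apply_le_add_half {Ω : Type*} [MeasurableSpace Ω] (Q : Measure Ω)
    [IsProbabilityMeasure Q] (L : Ω → ℝ≥0∞) (hL : Measurable L) (hL1 : ∫⁻ x, L x ∂Q = 1)
    (hL2 : ∫⁻ x, L x ^ 2 ∂Q ≤ 5 / 4) {s : Set Ω} (hs : MeasurableSet s) :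
    Q.withDensity L s ≤ Q s + 1 / 2 := by
  have hnum : (5 / 4 : ℝ≥0∞) = ((5 / 4 : NNReal) : ℝ≥0∞) := by
    rw [ENNReal.coe_div (by norm_num)]; norm_num
  -- A subtraction-free form of `1_s (L - 1) ≤ (L - 1)² + 1/4`; after integration the second moment
  -- contributes `1/4` and the constant another `1/4`.
  have hpt : ∀ x, s.indicator L x + 2 * L x ≤ s.indicator 1 x + L x ^ 2 + 5 / 4 := fun x => by
    rw [hnum]
    rcases eq_or_ne (L x) ⊤ with h | h
    · simp [h]
    lift L x to NNReal using h with y hy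
    by_cases hx : x ∈ s
    · rw [Set.indicator_of_mem hx, Set.indicator_of_mem hx, ← hy, Pi.one_apply]
      norm_cast
      rw [← NNReal.coe_le_coe]
      push_cast
      nlinarith [sq_nonneg ((y : ℝ) - 3 / 2)]
    · rw [Set.indicator_of_notMem hx, Set.indicator_of_notMem hx]
      norm_cast
      rw [← NNReal.coe_le_coe]
      push_cast
      nlinarith [sq_nonneg ((y : ℝ) - 1)]
  have hint := lintegral_mono (μ := Q) hpt
  rw [lintegral_add_right _ (hL.const_mul _), lintegral_indicator hs,
    lintegral_const_mul _ hL, hL1, lintegral_add_right _ measurable_const,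
    lintegral_add_right _ (hL.pow_const 2), lintegral_indicator_one hs, lintegral_const,
    measure_univ, mul_one, mul_one, ← withDensity_apply _ hs] at hint
  have h2 : Q.withDensity L s + 2 ≤ Q s + 1 / 2 + 2 := by
    refine hint.trans ((add_le_add_left (add_le_add_right hL2 _) _).trans (le_of_eq ?_))
    rw [add_assoc, add_assoc]
    congr 1
    have : (1 / 2 : ℝ≥0∞) = ((1 / 2 : NNReal) : ℝ≥0∞) := by
      rw [ENNReal.coe_div (by norm_num)]; norm_num
    rw [hnum, this]
    norm_cast
    ext
    push_cast
    norm_num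
  exact (ENNReal.add_le_add_iff_right (by norm_num)).1 h2

/-! ### The two-point lower bound -/

/-- Outliers that bring the `lam`-contaminations of `N(0, 1)` and `N(Δ, 1)` together: entirely when
`2 Δ < lam`, and up to a likelihood ratio of second moment `exp (Δ ^ 2)` otherwise. -/
lemma exists_contaminate_withDensity {Δ : ℝ} (h0 : 0 < Δ) (h1 : Δ ≤ 1) (lam : unitInterval) :
    ∃ (R₀ R₁ : Measure ℝ) (g : ℝ → ℝ≥0∞), IsProbabilityMeasure R₀ ∧ IsProbabilityMeasure R₁ ∧
      Measurable g ∧ contaminate lam (gaussianReal Δ 1) R₁ =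
        (contaminate lam (gaussianReal 0 1) R₀).withDensity g ∧
      ∫⁻ x, g x ^ 2 ∂contaminate lam (gaussianReal 0 1) R₀ =
        if (lam : ℝ) ≤ 2 * Δ then ENNReal.ofReal (Real.exp (Δ ^ 2)) else 1 := by
  by_cases h : (lam : ℝ) ≤ 2 * Δ
  -- At low rates the outliers are fresh draws from the clean distribution, so contamination changes
  -- nothing.
  · have hself : ∀ P : Measure ℝ, contaminate lam P P = P := fun P => by
      rw [contaminate, ← add_smul, toNNReal_symm_add_toNNReal, one_smul]
    refine ⟨gaussianReal 0 1, gaussianReal Δ 1, gaussianRatio Δ, inferInstance, inferInstance,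
      measurable_gaussianRatio Δ, ?_, ?_⟩
    · rw [hself, hself, withDensity_gaussianRatio]
    · rw [hself, lintegral_gaussianRatio_sq, if_pos h]
  · rw [not_le] at h
    obtain ⟨R₀, R₁, hR₀, hR₁, heq⟩ := exists_contaminate_eq (gaussianReal 0 1) (gaussianRatio Δ)
      (measurable_gaussianRatio Δ) (lintegral_gaussianRatio Δ) lam
      (by rintro rfl; rw [Set.Icc.coe_zero] at h; linarith)
      ((lintegral_gaussianRatio_sub_one_le h0 h1).trans (by
        rw [← ENNReal.ofReal_coe_nnreal]
        exact ENNReal.ofReal_le_ofReal h.le))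
    refine ⟨R₀, R₁, 1, hR₀, hR₁, measurable_one, ?_, ?_⟩
    · rw [withDensity_one, heq, withDensity_gaussianRatio]
    · simp [if_neg h.not_ge]

/-- The two-point lower bound: no estimator resolves means `Δ` apart, if few samples have corruption
rate at most `2 Δ`. -/
lemma exists_quarter_le_errorProb {n : ℕ} (lam : Fin n → unitInterval) {Δ : ℝ} (h0 : 0 < Δ)
    (h1 : Δ ≤ 1) (hN : numBelow lam (2 * Δ) * Δ ^ 2 ≤ 1 / 8) {M : (Fin n → ℝ) → ℝ}
    (hM : Measurable M) :
    ∃ P ∈ unitGaussians, ∃ κ : Adversary n ℝ,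
      1 / 4 ≤ errorProb lam P κ M (ENNReal.ofReal ((Δ / 2) ^ 2)) := by
  choose R₀ R₁ g hR₀ hR₁ hg hdens hsq using fun i => exists_contaminate_withDensity h0 h1 (lam i)
  let P₀ : ProbabilityMeasure ℝ := ⟨gaussianReal 0 1, inferInstance⟩
  let P₁ : ProbabilityMeasure ℝ := ⟨gaussianReal Δ 1, inferInstance⟩
  let ν : Fin n → Measure ℝ := fun i => contaminate (lam i) (gaussianReal 0 1) (R₀ i)
  let Q : Measure (Fin n → ℝ) := Measure.pi ν
  let L : (Fin n → ℝ) → ℝ≥0∞ := fun z => ∏ i, g i (z i)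
  have hL : Measurable L := Finset.measurable_fun_prod _ fun i _ =>
    (hg i).comp (measurable_pi_apply i)
  have hQ₀ : contaminatedLaw lam P₀ (obliviousAdversary R₀) = Q :=
    contaminatedLaw_obliviousAdversary lam P₀ R₀
  have hQ₁ : contaminatedLaw lam P₁ (obliviousAdversary R₁) = Q.withDensity L := by
    rw [contaminatedLaw_obliviousAdversary]
    change Measure.pi (fun i => contaminate (lam i) (gaussianReal Δ 1) (R₁ i)) = _
    have : ∀ i, IsProbabilityMeasure ((ν i).withDensity (g i)) := fun i => by
      rw [← hdens i]; infer_instance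
    simp_rw [hdens]
    exact pi_withDensity ν g hg
  have hprob : IsProbabilityMeasure (Q.withDensity L) := by
    rw [← hQ₁, contaminatedLaw_obliviousAdversary]
    change IsProbabilityMeasure (Measure.pi fun i => contaminate (lam i) (gaussianReal Δ 1) (R₁ i))
    infer_instance
  have hL1 : ∫⁻ z, L z ∂Q = 1 := by
    rw [← setLIntegral_univ, ← withDensity_apply _ MeasurableSet.univ, measure_univ]
  have hL2 : ∫⁻ z, L z ^ 2 ∂Q ≤ 5 / 4 := by
    simp only [L, ← Finset.prod_pow]
    rw [lintegral_pi_prod ν (fun i x => g i x ^ 2) fun i => (hg i).pow_const 2]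
    simp only [ν, hsq]
    -- Samples of rate above `2Δ` contribute a factor `1`, which leaves `exp(N(2Δ) Δ²)`; at exponent
    -- at most `1/8`, `exp x ≤ 1 + 2x` gives `5/4`.
    rw [← Finset.prod_filter, Finset.prod_const, ← ENNReal.ofReal_pow (Real.exp_pos _).le,
      ← Real.exp_nat_mul]
    have hexp := Real.abs_exp_sub_one_le (x := numBelow lam (2 * Δ) * Δ ^ 2)
      (by rw [abs_of_nonneg (by positivity)]; linarith)
    rw [abs_of_nonneg (a := (numBelow lam (2 * Δ) : ℝ) * Δ ^ 2) (by positivity)] at hexp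
    have h54 : (5 / 4 : ℝ≥0∞) = ENNReal.ofReal (5 / 4) := by
      rw [ENNReal.ofReal_div_of_pos (by norm_num)]; norm_num
    rw [h54]
    exact ENNReal.ofReal_le_ofReal (by
      change Real.exp (numBelow lam (2 * Δ) * Δ ^ 2) ≤ _
      linarith [(abs_le.1 hexp).2])
  have hmean₀ : mean P₀ = 0 := mean_eq_of_eq_gaussianReal rfl
  have hmean₁ : mean P₁ = Δ := mean_eq_of_eq_gaussianReal rfl
  let s : Set (Fin n → ℝ) := {z | ENNReal.ofReal ((Δ / 2) ^ 2) ≤ ENNReal.ofReal (‖M z - 0‖ ^ 2)}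
  have hs : MeasurableSet s := measurableSet_le measurable_const (by fun_prop)
  have he₀ : errorProb lam P₀ (obliviousAdversary R₀) M (ENNReal.ofReal ((Δ / 2) ^ 2)) = Q s := by
    rw [errorProb, hQ₀, hmean₀]
  -- An estimate within `Δ/2` of `0` is at least `Δ/2` away from `Δ`.
  have he₁ : Q.withDensity L sᶜ ≤
      errorProb lam P₁ (obliviousAdversary R₁) M (ENNReal.ofReal ((Δ / 2) ^ 2)) := by
    rw [errorProb, hQ₁, hmean₁]
    refine measure_mono fun z hz => ENNReal.ofReal_le_ofReal ?_
    have hz' : |M z| < Δ / 2 := by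
      by_contra! hcon
      refine hz (ENNReal.ofReal_le_ofReal ?_)
      rw [sub_zero, Real.norm_eq_abs]
      gcongr
    rw [Real.norm_eq_abs, sq_abs]
    have := (abs_lt.1 hz').2
    nlinarith
  by_contra! hcon
  have hlt₀ := hcon P₀ ⟨0, rfl⟩ (obliviousAdversary R₀)
  have hlt₁ := he₁.trans_lt (hcon P₁ ⟨Δ, rfl⟩ (obliviousAdversary R₁))
  rw [he₀] at hlt₀
  have hhalf := withDensity_apply_le_add_half Q L hL hL1 hL2 hs
  have hone := prob_add_prob_compl (μ := Q.withDensity L) hs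
  have hlt : (1 : ℝ≥0∞) < 1 := by
    calc (1 : ℝ≥0∞) = Q.withDensity L s + Q.withDensity L sᶜ := hone.symm
      _ ≤ (Q s + 1 / 2) + Q.withDensity L sᶜ := by gcongr
      _ < (1 / 4 + 1 / 2) + 1 / 4 :=
        ENNReal.add_lt_add (ENNReal.add_lt_add_right (by norm_num) hlt₀) hlt₁
      _ = 1 := by
        have h4 : (1 / 4 : ℝ≥0∞) = ENNReal.ofReal (1 / 4) := by
          rw [ENNReal.ofReal_div_of_pos (by norm_num)]; norm_num
        have h2 : (1 / 2 : ℝ≥0∞) = ENNReal.ofReal (1 / 2) := by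
          rw [ENNReal.ofReal_div_of_pos (by norm_num)]; norm_num
        rw [h4, h2, ← ENNReal.ofReal_add (by norm_num) (by norm_num),
          ← ENNReal.ofReal_add (by norm_num) (by norm_num)]
        norm_num
  exact lt_irrefl _ hlt

/-! ### The two sides of the minimax rate -/

lemma minRate_le_pacRate {n : ℕ} (lam : Fin n → unitInterval)
    (hf : minRate lam ≤ ENNReal.ofReal (1 / 225)) :
    ENNReal.ofReal (1 / 64) * minRate lam ≤ pacRate lam unitGaussians (1 / 5) := by
  obtain ⟨t, ht, hmin⟩ := exists_isMinOn_thresholdRate lam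
  have hft := minRate_eq_of_isMinOn ht hmin
  have hNt : 0 < numBelow lam t := numBelow_pos_of_thresholdRate_ne_top
    (hft ▸ ne_top_of_le_ne_top ENNReal.ofReal_ne_top hf)
  rw [thresholdRate_eq_ofReal hNt] at hft
  set F : ℝ := t ^ 2 + 1 / numBelow lam t with hF
  have hFpos : 0 < F := by
    have : (0 : ℝ) < numBelow lam t := by exact_mod_cast hNt
    positivity
  rw [hft] at hf
  have hF1 : F ≤ 1 / 225 := (ENNReal.ofReal_le_ofReal_iff (by norm_num)).1 hf
  have hsq : √F ^ 2 = F := Real.sq_sqrt hFpos.le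
  have hsqrt : 0 < √F := Real.sqrt_pos.2 hFpos
  have hs1 : √F ≤ 1 := by nlinarith
  -- With `Δ = √F/4`, minimality at `2Δ = √F/2` reads `F ≤ F/4 + 1/N(2Δ)`, so `N(2Δ) Δ² ≤ 1/12`.
  have hN : numBelow lam (2 * (√F / 4)) * (√F / 4) ^ 2 ≤ 1 / 8 := by
    rcases Nat.eq_zero_or_pos (numBelow lam (2 * (√F / 4))) with h | h
    · rw [h]; norm_num
    have h' : (0 : ℝ) < numBelow lam (2 * (√F / 4)) := by exact_mod_cast h
    have hle : minRate lam ≤ thresholdRate lam (2 * (√F / 4)) :=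
      iInf₂_le _ ⟨by positivity, by linarith⟩
    rw [hft, thresholdRate_eq_ofReal h, ENNReal.ofReal_le_ofReal_iff (by positivity)] at hle
    have hle' : 3 / 4 * F ≤ 1 / numBelow lam (2 * (√F / 4)) := by nlinarith
    rw [le_div_iff₀ h'] at hle'
    rw [div_pow, hsq]
    linarith
  refine le_sInf fun r hr => ?_
  rw [Set.mem_ofPred_eq] at hr
  by_contra! hlt
  refine absurd hr (not_le.2 ?_)
  -- The infimum over estimators need not be attained, so a uniform bound strictly above `1/5` is
  -- needed. The error radius is `(Δ/2)² = F/64`.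
  refine lt_of_lt_of_le (b := (1 / 4 : ℝ≥0∞)) ?_ (le_iInf fun M => ?_)
  · rw [one_div, one_div, ENNReal.inv_lt_inv]
    norm_num
  · obtain ⟨P, hP, κ, hκ⟩ := exists_quarter_le_errorProb lam (Δ := √F / 4) (by positivity)
      (by linarith) hN M.2
    refine hκ.trans (le_trans (measure_mono fun z hz => ?_)
      (le_iSup₂_of_le P hP (le_iSup (fun κ => errorProb lam P κ M.1 r) κ)))
    refine hlt.le.trans (le_trans (le_of_eq ?_) hz)
    rw [hft, ← ENNReal.ofReal_mul (by norm_num)]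
    congr 1
    rw [div_div, div_pow, hsq]
    ring

lemma pacRate_le_minRate {n : ℕ} (lam : Fin n → unitInterval)
    (hf : minRate lam ≤ ENNReal.ofReal (1 / 225)) :
    pacRate lam unitGaussians (1 / 5) ≤ ENNReal.ofReal 225 * minRate lam := by
  obtain ⟨t, ht, hmin⟩ := exists_isMinOn_thresholdRate lam
  rw [minRate_eq_of_isMinOn ht hmin] at hf ⊢
  have hN := numBelow_pos_of_thresholdRate_ne_top (ne_top_of_le_ne_top ENNReal.ofReal_ne_top hf)
  refine sInf_le ?_
  rw [Set.mem_ofPred_eq]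
  refine iInf_le_of_le ⟨lowerMedian (samplesBelow lam t),
    measurable_lowerMedian (samplesBelow_nonempty hN)⟩ (iSup₂_le fun P hP => iSup_le fun κ => ?_)
  exact errorProb_le_of_isTukeyMedian hf (isTukeyMedian_lowerMedian hN) hP κ

end HeteroRobust

theorem mainTheorem4 :
    ∃ c a A : ℝ, 0 < c ∧ 0 < a ∧ 0 < A ∧
      ∀ (n : ℕ) (lam : Fin n → unitInterval),
        HeteroRobust.minRate lam ≤ ENNReal.ofReal c →
        -- the minimax PAC rate is of the order of the minimum
        (ENNReal.ofReal a * HeteroRobust.minRate lam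
            ≤ HeteroRobust.pacRate lam HeteroRobust.unitGaussians (1 / 5) ∧
          HeteroRobust.pacRate lam HeteroRobust.unitGaussians (1 / 5)
            ≤ ENNReal.ofReal A * HeteroRobust.minRate lam) ∧
        -- the minimum is attained
        (∃ t ∈ Set.Icc (0 : ℝ) 1, IsMinOn (HeteroRobust.thresholdRate lam) (Set.Icc 0 1) t) ∧
        -- at every minimizer, the thresholded Tukey median is an estimator that achieves the
        -- rate, whichever of the deepest points it returns
        ∀ t ∈ Set.Icc (0 : ℝ) 1, IsMinOn (HeteroRobust.thresholdRate lam) (Set.Icc 0 1) t →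
          (∃ M : (Fin n → ℝ) → ℝ, Measurable M ∧
            ∀ z, HeteroRobust.IsTukeyMedian (HeteroRobust.thresholdWeight lam t) z (M z)) ∧
          ∀ M : (Fin n → ℝ) → ℝ,
            (∀ z, HeteroRobust.IsTukeyMedian (HeteroRobust.thresholdWeight lam t) z (M z)) →
            ∀ P ∈ HeteroRobust.unitGaussians, ∀ κ : HeteroRobust.Adversary n ℝ,
              HeteroRobust.errorProb lam P κ M (ENNReal.ofReal A * HeteroRobust.minRate lam)
                ≤ 1 / 5 := by
  refine ⟨1 / 225, 1 / 64, 225, by norm_num, by norm_num, by norm_num, fun n lam hf =>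
    ⟨⟨HeteroRobust.minRate_le_pacRate lam hf, HeteroRobust.pacRate_le_minRate lam hf⟩,
      HeteroRobust.exists_isMinOn_thresholdRate lam, fun t ht hmin => ?_⟩⟩
  rw [HeteroRobust.minRate_eq_of_isMinOn ht hmin] at hf ⊢
  have hN := HeteroRobust.numBelow_pos_of_thresholdRate_ne_top
    (ne_top_of_le_ne_top ENNReal.ofReal_ne_top hf)
  exact ⟨⟨HeteroRobust.lowerMedian (HeteroRobust.samplesBelow lam t),
      HeteroRobust.measurable_lowerMedian (HeteroRobust.samplesBelow_nonempty hN),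
      HeteroRobust.isTukeyMedian_lowerMedian hN⟩,
    fun M hM P hP κ => HeteroRobust.errorProb_le_of_isTukeyMedian hf hM hP κ⟩
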